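/- A $\{1,3\}$-tree is a finite tree $T$ in which every node has degree $1$ or $3$; let $E$ be its set of edges and $I$ its set of internal nodes, that is, nodes of degree $3$. Let $\mathcal{P}_T\subseteq\mathbb{R}^E$ be the set of all $w$ such that, for every $v\in I$ with incident edges $a,b,c$, $$w_a\le w_b+w_c,\quad w_b\le w_a+w_c,\quad w_c\le w_a+w_b,\quad w_a+w_b+w_c\le 1,$$ and such that $0\le w_e\le \tfrac12$ if $T$ consists of a single edge $e$. Let $\mathcal{Q}_T\subseteq\mathbb{R}^E\times\mathbb{R}^I$ be the set of all $(w,z)$ such that, for every $v\in I$ with incident edges $a,b,c$, $$w_a\le w_b+w_c,\quad w_b\le w_a+w_c,\quad w_c\le w_a+w_b,\quad w_a+w_b+w_c=2z_v,\quad z_v\le 1,$$ and such that $0\le w_e\le 1$ if $T$ consists of a single edge $e$. For an integer $t\ge 0$ let $$L^{\mathcal{P}}_T(t)=|t\mathcal{P}_T\cap\mathbb{Z}^E|,\qquad L^{\mathcal{Q}}_T(t)=|t\mathcal{Q}_T\cap(\mathbb{Z}^E\times\mathbb{Z}^I)|,$$ where $tX=\{tx: x\in X\}$. A function $f$ on the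 nonnegative integers is a quasi-polynomial if there are an integer $\alpha\ge1$ and polynomials $p_0,\dots,p_{\alpha-1}$ with $f(t)=p_i(t)$ whenever $t\equiv i \pmod{\alpha}$; the least such $\alpha$ is the period of $f$. Theorem. If $T$ is a $\{1,3\}$-tree, then $L^{\mathcal{P}}_T(t)$ is a quasi-polynomial of period exactly $2$, and $L^{\mathcal{Q}}_T(t)$ is a quasi-polynomial of period $1$, i.e. a polynomial in $t$. -/

import Mathlib

open scoped Pointwise

/-! ### Quasi-polynomials and Ehrhart functions -/

/-- `f` is given by a list of `α ≥ 1` polynomials `p 0, …, p (α - 1)`: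
`f t = p i (t)` whenever `t ≡ i (mod α)`. -/
def IsQuasiPolynomialMod (f : ℕ → ℕ) (α : ℕ) : Prop :=
  0 < α ∧ ∃ p : Fin α → Polynomial ℝ,
    ∀ (i : Fin α) (t : ℕ), t ≡ (i : ℕ) [MOD α] → (f t : ℝ) = (p i).eval (t : ℝ)

/-- `f` is a quasi-polynomial whose period, the least possible number of constituents, is `α`. -/
def IsQuasiPolynomialOfPeriod (f : ℕ → ℕ) (α : ℕ) : Prop :=
  IsLeast {β : ℕ | IsQuasiPolynomialMod f β} α

/-- The points of `ℝ^ι` with integer coordinates. -/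
def integerPoints (ι : Type*) : Set (ι → ℝ) :=
  {x | ∀ i, ∃ n : ℤ, x i = (n : ℝ)}

/-- The number of points of `Λ` in the dilate `tP = {t x : x ∈ P}`. -/
noncomputable def ehrhartFunction {M : Type*} [SMul ℝ M] (Λ P : Set M) (t : ℕ) : ℕ :=
  (((t : ℝ) • P) ∩ Λ).ncard

namespace SimpleGraph

variable {V : Type*} [Fintype V] (G : SimpleGraph V) [DecidableRel G.Adj]

/-- Every node has degree `1` or `3`. -/
def IsOneThreeGraph : Prop :=
  ∀ v, G.degree v = 1 ∨ G.degree v = 3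

/-- The internal nodes: those of degree `3`. -/
abbrev InternalNode : Type _ := {v : V // G.degree v = 3}

/-- `a`, `b`, `c` are three different edges incident to `v`; when `v` has degree `3` these are
the three edges at `v`, in any order. -/
def EdgesAt (v : V) (a b c : G.edgeSet) : Prop :=
  a ≠ b ∧ a ≠ c ∧ b ≠ c ∧ v ∈ (a : Sym2 V) ∧ v ∈ (b : Sym2 V) ∧ v ∈ (c : Sym2 V)

/-- The edge `e` alone is a component of the graph: no other edge meets it. -/
def IsComponentEdge (e : G.edgeSet) : Prop :=
  ∀ v ∈ (e : Sym2 V), ∀ f : G.edgeSet, v ∈ (f : Sym2 V) → f = e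

/-- The polytope `P_G` in `ℝ^E`. Since `a`, `b`, `c` range over all orderings of the edges at `v`,
the first line covers the three triangle inequalities at `v`. -/
def polytopeP : Set (G.edgeSet → ℝ) :=
  {w | (∀ (v : G.InternalNode) (a b c : G.edgeSet), G.EdgesAt v a b c →
          w a ≤ w b + w c ∧
          w a + w b + w c ≤ 1) ∧
       ∀ e, G.IsComponentEdge e → 0 ≤ w e ∧ w e ≤ 1 / 2}

/-- The polytope `Q_G` in `ℝ^E × ℝ^I`, where `I` is the set of internal nodes. -/
def polytopeQ : Set ((G.edgeSet → ℝ) × (G.InternalNode → ℝ)) :=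
  {wz | (∀ (v : G.InternalNode) (a b c : G.edgeSet), G.EdgesAt v a b c →
          wz.1 a ≤ wz.1 b + wz.1 c ∧
          wz.1 a + wz.1 b + wz.1 c = 2 * wz.2 v ∧
          wz.2 v ≤ 1) ∧
        ∀ e, G.IsComponentEdge e → 0 ≤ wz.1 e ∧ wz.1 e ≤ 1}

/-- `L^P_G(t)`, the number of integer points of `t P_G`. -/
noncomputable def ehrhartP (t : ℕ) : ℕ :=
  ehrhartFunction (integerPoints G.edgeSet) G.polytopeP t

/-- `L^Q_G(t)`, the number of integer points of `t Q_G`. -/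
noncomputable def ehrhartQ (t : ℕ) : ℕ :=
  ehrhartFunction (integerPoints G.edgeSet ×ˢ integerPoints G.InternalNode) G.polytopeQ t

end SimpleGraph

/-! The integer points of `t𝒫` and `t𝒬` are the labelings of the edges by `{0, …, ⌊t/2⌋}` and
`{0, …, t}`, respectively, that satisfy a symmetric rule at every internal node. Rooting `T` at a
leaf makes its edges the nodes of a binary tree, and the number of labelings with a given root label
is an iterated double sum over the labels of the two children.

For `𝒬`, and for `𝒫` at even `t`, the pairs of child labels of a given parity that are compatible
with a label `s` are the lattice points of a rectangle turned by 45 degrees. Summing a polynomial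
over such a rectangle gives a polynomial, so by induction these counts are polynomial.

The rule for `t𝒬` is preserved when two of the three labels are reflected by `a ↦ t - a`, so the
number of labelings is the same for the root labels `s` and `t - s`. If `t` is odd, every label is
uniquely `2a` or `t - 2a` with `a ≤ ⌊t/2⌋`; below an even label the two children must have the same
parity, and doubling turns the rule for `t𝒫` into the one for `t𝒬`. So every internal node, and the
choice of the root label, contributes a factor 2: `L^𝒬(t) = 2 ^ (n + 1) L^𝒫(t)` for odd `t`, where
`n` is the number of internal nodes. Hence the odd constituent of `L^𝒫` takes the value
`(2 ^ (n + 1))⁻¹` at `0`, whereas the even one takes the value `1`, and the period is not `1`.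
-/

section LabelCount

variable {α : Type*} [Fintype α]

open Classical in
/-- The number of labelings of a rooted binary tree by `α` whose root has label `s` and in which
every label `a` and the labels `b`, `c` of the two children satisfy `N a b c`. Every constructor of
`BinaryTree` carries a label, so that `nil` is a tree with a single labelled node. -/
noncomputable def labelCount (N : α → α → α → Prop) : BinaryTree Unit → α → ℕ
  | .nil, _ => 1
  | .node _ l r, s => ∑ b, ∑ c, if N s b c then labelCount N l b * labelCount N r c else 0

open Classical in
theorem card_subtype_prod_eq_sum {U₁ U₂ : Type*} [Finite U₁] [Finite U₂] (N : α → α → Prop)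
    (f₁ : U₁ → α) (f₂ : U₂ → α) (p₁ : U₁ → Prop) (p₂ : U₂ → Prop) :
    Nat.card {u : U₁ × U₂ // N (f₁ u.1) (f₂ u.2) ∧ p₁ u.1 ∧ p₂ u.2} =
      ∑ b, ∑ c, if N b c then
        Nat.card {u // f₁ u = b ∧ p₁ u} * Nat.card {u // f₂ u = c ∧ p₂ u} else 0 := by
  have := Fintype.ofFinite U₁
  have := Fintype.ofFinite U₂
  rw [Nat.subtype_card ({u | N (f₁ u.1) (f₂ u.2) ∧ p₁ u.1 ∧ p₂ u.2} : Finset (U₁ × U₂)) (by simp),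
    Finset.card_eq_sum_card_fiberwise (f := fun u => (f₁ u.1, f₂ u.2)) (t := Finset.univ)
      (fun _ _ => by simp), ← Finset.univ_product_univ, Finset.sum_product]
  refine Finset.sum_congr rfl fun b _ => Finset.sum_congr rfl fun c _ => ?_
  rw [Finset.filter_filter]
  split_ifs with hN
  · rw [Nat.subtype_card ({u | f₁ u = b ∧ p₁ u} : Finset U₁) (by simp),
      Nat.subtype_card ({u | f₂ u = c ∧ p₂ u} : Finset U₂) (by simp), ← Finset.card_product]
    congr 1
    ext u
    simp only [Finset.mem_filter, Finset.mem_univ, true_and, Finset.mem_product, Prod.mk.injEq]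
    grind
  · rw [Finset.card_eq_zero, Finset.filter_eq_empty_iff]
    simp only [Finset.mem_univ, Prod.mk.injEq]
    grind

end LabelCount

section Forest

variable {X : Type*} {R : X → X → Prop}

/-- `R` is the relation "is a child of" of a rooted forest in which every node has no child or
two children. -/
structure IsBinaryForest (R : X → X → Prop) : Prop where
  wellFounded : WellFounded R
  rightUnique : Relator.RightUnique R
  children (x : X) : (∀ y, ¬ R y x) ∨ ∃ y z, y ≠ z ∧ R y x ∧ R z x ∧ ∀ u, R u x → u = y ∨ u = z

/-- The branch at `x` of the forest with child relation `R`: the node `x` and its descendants. -/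
def branch (R : X → X → Prop) (x : X) : Set X :=
  {y | Relation.ReflTransGen R y x}

/-- The root of a branch, as one of its elements. -/
def branchRoot (R : X → X → Prop) (x : X) : branch R x :=
  ⟨x, .refl⟩

/-- `w` labels the nodes of the forest with child relation `R` so that the label `a` of a node and
the labels `b`, `c` of its two children satisfy `N a b c`. -/
def IsForestLabeling {α : Type*} (R : X → X → Prop) (N : α → α → α → Prop) (w : X → α) : Prop :=
  ∀ x y z, y ≠ z → R y x → R z x → N (w x) (w y) (w z)

theorem branch_subset_branch {x y : X} (h : R y x) : branch R y ⊆ branch R x :=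
  fun _ hu => hu.tail h

theorem mem_branch_iff_of_children {x y z u : X} (hy : R y x) (hz : R z x)
    (h : ∀ u, R u x → u = y ∨ u = z) :
    u ∈ branch R x ↔ u = x ∨ u ∈ branch R y ∨ u ∈ branch R z := by
  constructor
  · intro hu
    rcases Relation.ReflTransGen.cases_tail hu with rfl | ⟨v, huv, hv⟩
    · exact .inl rfl
    · rcases h v hv with rfl | rfl
      · exact .inr (.inl huv)
      · exact .inr (.inr huv)
  · rintro (rfl | hu | hu)
    exacts [.refl, branch_subset_branch hy hu, branch_subset_branch hz hu]

namespace IsBinaryForest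

theorem notMem_branch_of_child (h : IsBinaryForest R) {x y : X} (hy : R y x) : x ∉ branch R y := by
  intro hx
  exact (WellFounded.irrefl h.wellFounded.transGen).irrefl x (Relation.TransGen.tail' hx hy)

theorem eq_of_mem_branch_sibling (h : IsBinaryForest R) {x y z : X} (hy : R y x) (hz : R z x)
    (hyz : y ∈ branch R z) : y = z := by
  rcases Relation.ReflTransGen.cases_head hyz with rfl | ⟨u, hu, huz⟩
  · rfl
  · exact absurd (h.rightUnique hu hy ▸ huz) (h.notMem_branch_of_child hz)

theorem disjoint_branch (h : IsBinaryForest R) {x y z : X} (hyz : y ≠ z) (hy : R y x)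
    (hz : R z x) : Disjoint (branch R y) (branch R z) := by
  refine Set.disjoint_left.mpr fun u huy huz => hyz ?_
  rcases Relation.ReflTransGen.total_of_right_unique h.rightUnique huy huz with hyz | hzy
  · exact h.eq_of_mem_branch_sibling hy hz hyz
  · exact (h.eq_of_mem_branch_sibling hz hy hzy).symm

end IsBinaryForest

/-- The decomposition of a branch into its root and the branches at the two children. -/
def branchGlue {x y z : X} (hy : R y x) (hz : R z x) :
    Option (branch R y ⊕ branch R z) → branch R x
  | none => branchRoot R x
  | some (.inl u) => Set.inclusion (branch_subset_branch hy) u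
  | some (.inr u) => Set.inclusion (branch_subset_branch hz) u

namespace IsBinaryForest

theorem bijective_branchGlue (h : IsBinaryForest R) {x y z : X} (hyz : y ≠ z) (hy : R y x)
    (hz : R z x) (hx : ∀ u, R u x → u = y ∨ u = z) : Function.Bijective (branchGlue hy hz) := by
  have hdisj := Set.disjoint_left.mp (h.disjoint_branch hyz hy hz)
  have hxy := h.notMem_branch_of_child hy
  have hxz := h.notMem_branch_of_child hz
  constructor
  · rintro (_ | u | u) (_ | v | v) huv <;>
      simp only [branchGlue, branchRoot, Set.inclusion, Subtype.mk.injEq] at huv <;> grind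
  · rintro ⟨u, hu⟩
    rcases (mem_branch_iff_of_children hy hz hx).mp hu with rfl | hu | hu
    exacts [⟨none, rfl⟩, ⟨some (.inl ⟨u, hu⟩), rfl⟩, ⟨some (.inr ⟨u, hu⟩), rfl⟩]

end IsBinaryForest

theorem isForestLabeling_branch_iff {α : Type*} {N : α → α → α → Prop}
    (hN : ∀ a b c, N a b c → N a c b) {x y z : X} (hyz : y ≠ z) (hy : R y x) (hz : R z x)
    (hx : ∀ u, R u x → u = y ∨ u = z) (w : branch R x → α) :
    IsForestLabeling (Subrel R (· ∈ branch R x)) N w ↔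
      N (w (branchRoot R x)) (w (branchGlue hy hz (some (.inl (branchRoot R y)))))
        (w (branchGlue hy hz (some (.inr (branchRoot R z))))) ∧
      IsForestLabeling (Subrel R (· ∈ branch R y)) N
        (fun u => w (branchGlue hy hz (some (.inl u)))) ∧
      IsForestLabeling (Subrel R (· ∈ branch R z)) N
        (fun u => w (branchGlue hy hz (some (.inr u)))) := by
  constructor
  · intro hw
    exact ⟨hw _ _ _ (fun huv => hyz (congrArg Subtype.val huv)) hy hz,
      fun u _ _ hvv => hw (Set.inclusion (branch_subset_branch hy) u) _ _
        ((Set.inclusion_injective (branch_subset_branch hy)).ne hvv),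
      fun u _ _ hvv => hw (Set.inclusion (branch_subset_branch hz) u) _ _
        ((Set.inclusion_injective (branch_subset_branch hz)).ne hvv)⟩
  · rintro ⟨hroot, hwy, hwz⟩ ⟨u, hu⟩ ⟨v, _⟩ ⟨v', _⟩ hvv hv hv'
    rw [ne_eq, Subtype.mk.injEq] at hvv
    rcases (mem_branch_iff_of_children hy hz hx).mp hu with rfl | hu | hu
    · rcases hx v hv with rfl | rfl <;> rcases hx v' hv' with rfl | rfl
      exacts [absurd rfl hvv, hroot, hN _ _ _ hroot, absurd rfl hvv]
    · exact hwy ⟨u, hu⟩ ⟨v, hu.head hv⟩ ⟨v', hu.head hv'⟩ (by grind) hv hv'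
    · exact hwz ⟨u, hu⟩ ⟨v, hu.head hv⟩ ⟨v', hu.head hv'⟩ (by grind) hv hv'

/-- The number of labelings of the branch at `x` with label `s` at `x`. -/
noncomputable def branchCount {α : Type*} (R : X → X → Prop) (N : α → α → α → Prop) (x : X)
    (s : α) : ℕ :=
  Nat.card {w : branch R x → α //
    w (branchRoot R x) = s ∧ IsForestLabeling (Subrel R (· ∈ branch R x)) N w}

theorem branchCount_of_isLeaf {α : Type*} {N : α → α → α → Prop} {x : X} (hx : ∀ u, ¬ R u x)
    (s : α) : branchCount R N x s = 1 := by
  have hroot (u : branch R x) : u = branchRoot R x := by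
    obtain ⟨u, hu⟩ := u
    rcases Relation.ReflTransGen.cases_tail hu with rfl | ⟨v, -, hv⟩
    exacts [rfl, absurd hv (hx v)]
  rw [branchCount, Nat.card_eq_one_iff_exists]
  refine ⟨⟨fun _ => s, rfl, fun u v _ _ hv _ => absurd hv (hroot u ▸ hx v)⟩, fun w => ?_⟩
  exact Subtype.ext (funext fun u => hroot u ▸ w.2.1)

namespace IsBinaryForest

variable [Finite X] {α : Type*} [Fintype α] {N : α → α → α → Prop}

open Classical in
theorem branchCount_of_children (h : IsBinaryForest R) (hN : ∀ a b c, N a b c → N a c b)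
    {x y z : X} (hyz : y ≠ z) (hy : R y x) (hz : R z x) (hx : ∀ u, R u x → u = y ∨ u = z)
    (s : α) : branchCount R N x s =
      ∑ b, ∑ c, if N s b c then branchCount R N y b * branchCount R N z c else 0 := by
  let glue := Equiv.ofBijective _ (h.bijective_branchGlue hyz hy hz hx)
  let split : (branch R x → α) ≃ α × (branch R y → α) × (branch R z → α) :=
    (glue.arrowCongr (.refl α)).symm.trans <| (Equiv.piOptionEquivProd).trans <|
      (Equiv.refl α).prodCongr (Equiv.sumArrowEquivProdArrow _ _ _)
  simp only [branchCount]
  rw [← card_subtype_prod_eq_sum (N s) (fun w : branch R y → α => w (branchRoot R y))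
    (fun w : branch R z → α => w (branchRoot R z))]
  refine Nat.card_congr <| (split.subtypeEquiv (p := _) (q := fun u =>
    u.1 = s ∧ N u.1 (u.2.1 (branchRoot R y)) (u.2.2 (branchRoot R z)) ∧
      IsForestLabeling (Subrel R (· ∈ branch R y)) N u.2.1 ∧
      IsForestLabeling (Subrel R (· ∈ branch R z)) N u.2.2)
    fun w => and_congr Iff.rfl (isForestLabeling_branch_iff hN hyz hy hz hx w)).trans ?_
  exact {
    toFun u := ⟨u.1.2, by simpa only [u.2.1] using u.2.2⟩
    invFun u := ⟨(s, u.1), rfl, u.2⟩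
    left_inv u := Subtype.ext (Prod.ext u.2.1.symm rfl)
    right_inv _ := rfl }

end IsBinaryForest

theorem IsBinaryForest.exists_branchCount_eq_labelCount [Finite X] (h : IsBinaryForest R) (x : X) :
    ∃ τ : BinaryTree Unit, ∀ {α : Type} [Fintype α] {N : α → α → α → Prop},
      (∀ a b c, N a b c → N a c b) → ∀ s, branchCount R N x s = labelCount N τ s := by
  induction x using h.wellFounded.induction with
  | _ x ih =>
    rcases h.children x with hleaf | ⟨y, z, hyz, hy, hz, hx⟩
    · exact ⟨.nil, fun _ s => by rw [branchCount_of_isLeaf hleaf, labelCount]⟩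
    · obtain ⟨l, hl⟩ := ih y hy
      obtain ⟨r, hr⟩ := ih z hz
      refine ⟨.node () l r, fun hN s => ?_⟩
      rw [h.branchCount_of_children hN hyz hy hz hx, labelCount]
      simp only [hl hN, hr hN]

theorem card_forestLabeling_eq_sum_branchCount [Finite X] {α : Type*} [Fintype α]
    {N : α → α → α → Prop} {x : X} (hx : ∀ u, u ∈ branch R x) :
    Nat.card {w : X → α // IsForestLabeling R N w} = ∑ s, branchCount R N x s := by
  let restrict : (X → α) ≃ (branch R x → α) :=
    (Equiv.arrowCongr (Equiv.subtypeUnivEquiv hx) (.refl α)).symm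
  have hrestrict (w : X → α) : IsForestLabeling R N w ↔
      IsForestLabeling (Subrel R (· ∈ branch R x)) N (restrict w) :=
    ⟨fun hw u v v' hvv => hw u v v' (Subtype.coe_ne_coe.mpr hvv),
      fun hw u v v' hvv => hw ⟨u, hx u⟩ ⟨v, hx v⟩ ⟨v', hx v'⟩ (by simpa using hvv)⟩
  rw [Nat.card_congr (restrict.subtypeEquiv hrestrict), ← Nat.card_congr
    (Equiv.sigmaFiberEquiv fun w : {w // IsForestLabeling (Subrel R (· ∈ branch R x)) N w} =>
      w.1 (branchRoot R x)), Nat.card_sigma]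
  refine Finset.sum_congr rfl fun s _ => Nat.card_congr ?_
  exact (Equiv.subtypeSubtypeEquivSubtypeInter _ fun w : branch R x → α =>
    w (branchRoot R x) = s).trans (Equiv.subtypeEquivRight fun _ => and_comm)

end Forest

section EdgesAt

variable {V : Type*} {G : SimpleGraph V} {v : V} {a b c : G.edgeSet}

theorem edgesAt_swap_left (h : G.EdgesAt v a b c) : G.EdgesAt v b a c :=
  ⟨h.1.symm, h.2.2.1, h.2.1, h.2.2.2.2.1, h.2.2.2.1, h.2.2.2.2.2⟩

theorem edgesAt_swap_right (h : G.EdgesAt v a b c) : G.EdgesAt v a c b :=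
  ⟨h.2.1, h.1, h.2.2.1.symm, h.2.2.2.1, h.2.2.2.2.2, h.2.2.2.2.1⟩

variable [Fintype V] [DecidableRel G.Adj]

open Classical in
/-- The edges at a node. -/
noncomputable def incidentEdges (G : SimpleGraph V) [DecidableRel G.Adj] (v : V) :
    Finset G.edgeSet :=
  {e | v ∈ (e : Sym2 V)}

theorem mem_incidentEdges {e : G.edgeSet} : e ∈ incidentEdges G v ↔ v ∈ (e : Sym2 V) := by
  simp only [incidentEdges, Finset.mem_filter, Finset.mem_univ, true_and]

theorem card_incidentEdges (v : V) : (incidentEdges G v).card = G.degree v := by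
  classical
  rw [← G.card_incidenceFinset_eq_degree, ← Finset.card_map (Function.Embedding.subtype _)]
  congr 1
  ext e
  simp [mem_incidentEdges, SimpleGraph.incidenceSet, and_comm]

open Classical in
theorem incidentEdges_eq_of_edgesAt (hv : G.degree v = 3) (h : G.EdgesAt v a b c) :
    incidentEdges G v = {a, b, c} := by
  obtain ⟨hab, hac, hbc, ha, hb, hc⟩ := h
  refine (Finset.eq_of_subset_of_card_le (by grind [mem_incidentEdges]) ?_).symm
  rw [card_incidentEdges, hv, Finset.card_eq_three.mpr ⟨a, b, c, hab, hac, hbc, rfl⟩]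

theorem exists_edgesAt_of_mem (hv : G.degree v = 3) (ha : v ∈ (a : Sym2 V)) :
    ∃ b c, G.EdgesAt v a b c := by
  classical
  have hcard : ((incidentEdges G v).erase a).card = 2 := by
    rw [Finset.card_erase_of_mem (mem_incidentEdges.mpr ha), card_incidentEdges, hv]
  obtain ⟨b, c, hbc, hset⟩ := Finset.card_eq_two.mp hcard
  have hmem (e : G.edgeSet) : e = b ∨ e = c ↔ e ≠ a ∧ v ∈ (e : Sym2 V) := by
    rw [← mem_incidentEdges, ← Finset.mem_erase, hset, Finset.mem_insert, Finset.mem_singleton]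
  have hb := (hmem b).mp (.inl rfl)
  have hc := (hmem c).mp (.inr rfl)
  exact ⟨b, c, hb.1.symm, hc.1.symm, hbc, ha, hb.2, hc.2⟩

theorem eq_of_degree_eq_one (hv : G.degree v = 1) (ha : v ∈ (a : Sym2 V))
    (hb : v ∈ (b : Sym2 V)) : a = b :=
  Finset.card_le_one.mp (by rw [card_incidentEdges, hv]) _ (mem_incidentEdges.mpr ha) _
    (mem_incidentEdges.mpr hb)

end EdgesAt

section Rooting

variable {V : Type*} {G : SimpleGraph V}

/-- `w` labels the edges of `G` so that the labels `a`, `b`, `c` of the three edges at every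
internal node satisfy `N a b c`. -/
def IsEdgeLabeling {α : Type*} [Fintype V] (G : SimpleGraph V) [DecidableRel G.Adj]
    (N : α → α → α → Prop) (w : G.edgeSet → α) : Prop :=
  ∀ (v : G.InternalNode) (a b c : G.edgeSet), G.EdgesAt v a b c → N (w a) (w b) (w c)

/-- `lower e` is the end of the edge `e` farther from the root `r`, and every node other than `r`
is the lower end of exactly one edge. -/
structure IsRooting (G : SimpleGraph V) (r : V) (lower : G.edgeSet → V) : Prop where
  lower_mem (e : G.edgeSet) : lower e ∈ (e : Sym2 V)
  dist_add_one {e : G.edgeSet} {u : V} (hu : u ∈ (e : Sym2 V)) (hne : u ≠ lower e) :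
    G.dist r u + 1 = G.dist r (lower e)
  injective : Function.Injective lower
  exists_lower_eq {v : V} (hv : v ≠ r) : ∃ e, lower e = v

/-- The edge `f` hangs from the edge `e`, in a tree whose edges have the lower ends `lower`. -/
def IsChildEdge (lower : G.edgeSet → V) (f e : G.edgeSet) : Prop :=
  f ≠ e ∧ lower e ∈ (f : Sym2 V)

theorem exists_adj_dist_add_one (hG : G.IsTree) {r v : V} (hv : v ≠ r) :
    ∃ u, G.Adj u v ∧ G.dist r u + 1 = G.dist r v := by
  obtain ⟨p, hp⟩ := hG.connected.exists_walk_length_eq_dist v r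
  obtain ⟨u, hvu, q, rfl⟩ := p.exists_eq_cons_of_ne hv
  have hq := SimpleGraph.dist_le q
  rw [SimpleGraph.Walk.length_cons] at hp
  rw [G.dist_comm] at hp hq
  exact ⟨u, hvu.symm, by have := hG.dist_eq_dist_add_one_of_adj r hvu; omega⟩

theorem exists_farther_end (hG : G.IsTree) (r : V) (e : G.edgeSet) :
    ∃ v ∈ (e : Sym2 V), ∀ u ∈ (e : Sym2 V), u ≠ v → G.dist r u + 1 = G.dist r v := by
  obtain ⟨⟨u, v⟩, huv⟩ := e
  rcases hG.dist_eq_dist_add_one_of_adj r huv with h | h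
  · exact ⟨u, Sym2.mem_mk_left u v, by grind⟩
  · exact ⟨v, Sym2.mem_mk_right u v, by grind⟩

theorem exists_isRooting [Finite V] (hG : G.IsTree) (r : V) : ∃ lower, IsRooting G r lower := by
  classical
  have := Fintype.ofFinite V
  choose lower hmem hdist using exists_farther_end hG r
  have hsurj {v : V} (hv : v ≠ r) : ∃ e, lower e = v := by
    obtain ⟨u, huv, hu⟩ := exists_adj_dist_add_one hG hv
    refine ⟨⟨s(u, v), huv⟩, by_contra fun hne => ?_⟩
    have hlower := (Sym2.mem_iff.mp (hmem ⟨s(u, v), huv⟩)).resolve_right hne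
    have := hdist ⟨s(u, v), huv⟩ v (Sym2.mem_mk_right u v) (Ne.symm hne)
    rw [hlower] at this
    omega
  have hne (e : G.edgeSet) : lower e ≠ r := by
    intro hr
    have := hdist e (Sym2.Mem.other (hmem e)) (Sym2.other_mem _)
      (G.edge_other_ne e.2 (hmem e))
    simp [hr] at this
  have hcard : Fintype.card G.edgeSet = Fintype.card {v // v ≠ r} := by
    have := hG.card_edgeFinset
    rw [G.edgeFinset_card] at this
    rw [Fintype.card_subtype_compl, Fintype.card_subtype_eq, ← this, Nat.add_sub_cancel]
  have hbij : Function.Bijective fun e => (⟨lower e, hne e⟩ : {v // v ≠ r}) :=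
    (Fintype.bijective_iff_surjective_and_card _).mpr
      ⟨fun ⟨v, hv⟩ => (hsurj hv).imp fun e he => Subtype.ext he, hcard⟩
  exact ⟨lower, hmem, fun hu => hdist _ _ hu, fun e f hef => hbij.1 (Subtype.ext hef), hsurj⟩

namespace IsRooting

variable {r : V} {lower : G.edgeSet → V}

theorem dist_lower_of_isChildEdge (h : IsRooting G r lower) {e f : G.edgeSet}
    (hfe : IsChildEdge lower f e) : G.dist r (lower e) + 1 = G.dist r (lower f) :=
  h.dist_add_one hfe.2 (h.injective.ne hfe.1.symm)

theorem wellFounded_isChildEdge [Finite V] (h : IsRooting G r lower) :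
    WellFounded (IsChildEdge lower) := by
  have hwf : WellFounded (InvImage (· > ·) fun e => G.dist r (lower e)) :=
    have : IsTrans _ (InvImage (· > ·) fun e => G.dist r (lower e)) :=
      ⟨fun _ _ _ => gt_trans⟩
    have : Std.Irrefl (InvImage (· > ·) fun e => G.dist r (lower e)) := ⟨fun _ => lt_irrefl _⟩
    Finite.wellFounded_of_trans_of_irrefl _
  exact hwf.mono fun f e hfe => Nat.lt_of_succ_le (h.dist_lower_of_isChildEdge hfe).le

theorem rightUnique_isChildEdge (h : IsRooting G r lower) :
    Relator.RightUnique (IsChildEdge lower) := by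
  intro f e e' he he'
  have hother {e : G.edgeSet} (he : IsChildEdge lower f e) :
      lower e = Sym2.Mem.other (h.lower_mem f) := by
    have := Sym2.other_spec (h.lower_mem f) ▸ he.2
    exact (Sym2.mem_iff.mp this).resolve_left (h.injective.ne he.1.symm)
  exact h.injective ((hother he).trans (hother he').symm)

variable [Fintype V] [DecidableRel G.Adj]

theorem isBinaryForest (h : IsRooting G r lower) (h13 : G.IsOneThreeGraph) :
    IsBinaryForest (IsChildEdge lower) where
  wellFounded := h.wellFounded_isChildEdge
  rightUnique := h.rightUnique_isChildEdge
  children e := by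
    classical
    rcases h13 (lower e) with hdeg | hdeg
    · exact .inl fun f hf => hf.1 (eq_of_degree_eq_one hdeg hf.2 (h.lower_mem e))
    · obtain ⟨b, c, habc⟩ := exists_edgesAt_of_mem hdeg (h.lower_mem e)
      refine .inr ⟨b, c, habc.2.2.1, ⟨habc.1.symm, habc.2.2.2.2.1⟩,
        ⟨habc.2.1.symm, habc.2.2.2.2.2⟩, fun f hf => ?_⟩
      have hmem := mem_incidentEdges.mpr hf.2
      rw [incidentEdges_eq_of_edgesAt hdeg habc] at hmem
      grind [IsChildEdge]

theorem mem_branch_of_degree_eq_one (h : IsRooting G r lower) (hr : G.degree r = 1)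
    {e₀ : G.edgeSet} (he₀ : r ∈ (e₀ : Sym2 V)) (f : G.edgeSet) :
    f ∈ branch (IsChildEdge lower) e₀ := by
  induction hn : G.dist r (lower f) using Nat.strong_induction_on generalizing f with
  | _ n ih =>
    let u := Sym2.Mem.other (h.lower_mem f)
    have hu : u ∈ (f : Sym2 V) := Sym2.other_mem _
    have hne : u ≠ lower f := G.edge_other_ne f.2 (h.lower_mem f)
    by_cases hur : u = r
    · rw [eq_of_degree_eq_one (a := f) hr (hur ▸ hu) he₀]
      exact Relation.ReflTransGen.refl
    · obtain ⟨e, he⟩ := h.exists_lower_eq hur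
      have hfe : IsChildEdge lower f e := ⟨fun hfe => hne (hfe ▸ he.symm), he ▸ hu⟩
      have hlt := h.dist_lower_of_isChildEdge hfe
      exact (ih _ (by omega) e rfl).head hfe

variable {α : Type*} {N : α → α → α → Prop}

theorem isEdgeLabeling_iff (h : IsRooting G r lower) (hr : G.degree r = 1)
    (h13 : G.IsOneThreeGraph) (hleft : ∀ a b c, N a b c → N b a c)
    (hright : ∀ a b c, N a b c → N a c b) (w : G.edgeSet → α) :
    IsEdgeLabeling G N w ↔ IsForestLabeling (IsChildEdge lower) N w := by
  classical
  constructor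
  · intro hw e f g hfg hf hg
    have hne : G.degree (lower e) ≠ 1 := fun hdeg =>
      hf.1 (eq_of_degree_eq_one hdeg hf.2 (h.lower_mem e))
    exact hw ⟨lower e, (h13 _).resolve_left hne⟩ e f g
      ⟨hf.1.symm, hg.1.symm, hfg, h.lower_mem e, hf.2, hg.2⟩
  · rintro hw ⟨v, hv⟩ a b c habc
    obtain ⟨e, rfl⟩ := h.exists_lower_eq (v := v) (by rintro rfl; omega)
    have he := mem_incidentEdges.mpr (h.lower_mem e)
    rw [incidentEdges_eq_of_edgesAt hv habc] at he
    simp only [Finset.mem_insert, Finset.mem_singleton] at he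
    obtain ⟨hab, hac, hbc, ha, hb, hc⟩ := habc
    rcases he with rfl | rfl | rfl
    · exact hw _ _ _ hbc ⟨hab.symm, hb⟩ ⟨hac.symm, hc⟩
    · exact hleft _ _ _ (hw _ _ _ hac ⟨hab, ha⟩ ⟨hbc.symm, hc⟩)
    · exact hright _ _ _ (hleft _ _ _ (hw _ _ _ hab ⟨hac, ha⟩ ⟨hbc, hb⟩))

end IsRooting

theorem exists_card_edgeLabeling_eq_sum_labelCount [Fintype V] [DecidableRel G.Adj]
    (hG : G.IsTree) (h13 : G.IsOneThreeGraph) :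
    ∃ τ : BinaryTree Unit, ∀ {α : Type} [Fintype α] {N : α → α → α → Prop},
      (∀ a b c, N a b c → N b a c) → (∀ a b c, N a b c → N a c b) →
        Nat.card {w // IsEdgeLabeling G N w} = ∑ s, labelCount N τ s := by
  have : Nontrivial V := by
    obtain ⟨v⟩ := hG.connected.nonempty
    have hpos : 0 < G.degree v := by rcases h13 v with h | h <;> omega
    obtain ⟨u, hu⟩ := (G.degree_pos_iff_exists_adj v).mp hpos
    exact ⟨v, u, hu.ne⟩
  obtain ⟨r, hr⟩ := hG.exists_vert_degree_one_of_nontrivial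
  obtain ⟨u, hu⟩ := (G.degree_pos_iff_exists_adj r).mp (by omega)
  obtain ⟨lower, h⟩ := exists_isRooting hG r
  let e₀ : G.edgeSet := ⟨s(r, u), hu⟩
  obtain ⟨τ, hτ⟩ := (h.isBinaryForest h13).exists_branchCount_eq_labelCount e₀
  refine ⟨τ, fun hleft hright => ?_⟩
  simp only [h.isEdgeLabeling_iff hr h13 hleft hright, ← hτ hright]
  exact card_forestLabeling_eq_sum_branchCount
    (h.mem_branch_of_degree_eq_one hr (Sym2.mem_mk_left r u))

end Rooting

section LatticePoints

/-- Three labels satisfy the triangle inequalities and have sum at most `t`. -/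
def TriangleRule (t : ℕ) {n : ℕ} (a b c : Fin n) : Prop :=
  (a : ℕ) ≤ b + c ∧ (b : ℕ) ≤ a + c ∧ (c : ℕ) ≤ a + b ∧ (a + b + c : ℕ) ≤ t

/-- Three labels satisfy the triangle inequalities and their sum is twice an integer which is at
most `t`, the coordinate of `𝒬` at an internal node. -/
def EvenTriangleRule (t : ℕ) {n : ℕ} (a b c : Fin n) : Prop :=
  TriangleRule (2 * t) a b c ∧ Even (a + b + c : ℕ)

theorem ehrhartFunction_zero {M : Type*} [AddCommGroup M] [Module ℝ M] {Λ P : Set M}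
    (hΛ : 0 ∈ Λ) (hP : P.Nonempty) : ehrhartFunction Λ P 0 = 1 := by
  rw [ehrhartFunction, Nat.cast_zero, Set.zero_smul_set hP, ← Set.singleton_zero,
    Set.inter_eq_left.mpr (Set.singleton_subset_iff.mpr hΛ), Set.ncard_singleton]

theorem exists_fin_natCast_eq {ι : Type*} {n : ℕ} {x : ι → ℝ} (hx : x ∈ integerPoints ι)
    (hbounds : ∀ i, 0 ≤ x i ∧ x i < n) : ∃ w : ι → Fin n, (fun i => ((w i : ℕ) : ℝ)) = x := by
  choose k hk using hx
  have hk0 (i : ι) : 0 ≤ k i := by exact_mod_cast hk i ▸ (hbounds i).1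
  have hkn (i : ι) : k i < n := by exact_mod_cast hk i ▸ (hbounds i).2
  refine ⟨fun i => ⟨(k i).toNat, by have := hk0 i; have := hkn i; omega⟩, funext fun i => ?_⟩
  rw [hk i]
  exact_mod_cast Int.toNat_of_nonneg (hk0 i)

theorem fin_natCast_comp_injective (ι : Type*) (n : ℕ) :
    Function.Injective fun (w : ι → Fin n) (i : ι) => ((w i : ℕ) : ℝ) :=
  (Nat.cast_injective.comp Fin.val_injective).comp_left

theorem triangleRule_of_edgesAt {V : Type*} {G : SimpleGraph V} {t n : ℕ} {w : G.edgeSet → Fin n}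
    {v : V} {a b c : G.edgeSet}
    (hw : ∀ a b c : G.edgeSet, G.EdgesAt v a b c →
      ((w a : ℕ) : ℝ) ≤ (w b : ℕ) + (w c : ℕ) ∧ ((w a : ℕ) : ℝ) + (w b : ℕ) + (w c : ℕ) ≤ t)
    (h : G.EdgesAt v a b c) : TriangleRule t (w a) (w b) (w c) :=
  ⟨mod_cast (hw _ _ _ h).1, mod_cast (hw _ _ _ (edgesAt_swap_left h)).1,
    mod_cast (hw _ _ _ (edgesAt_swap_left (edgesAt_swap_right h))).1, mod_cast (hw _ _ _ h).2⟩

variable {V : Type*} [Fintype V] {G : SimpleGraph V} [DecidableRel G.Adj]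

theorem isComponentEdge_or_exists_edgesAt (h13 : G.IsOneThreeGraph) (e : G.edgeSet) :
    G.IsComponentEdge e ∨ ∃ (v : G.InternalNode) (b c : G.edgeSet), G.EdgesAt v e b c := by
  by_cases h : ∃ v ∈ (e : Sym2 V), G.degree v = 3
  · obtain ⟨v, hve, hv⟩ := h
    exact .inr ⟨⟨v, hv⟩, exists_edgesAt_of_mem hv hve⟩
  · push Not at h
    exact .inl fun v hve f hvf => eq_of_degree_eq_one ((h13 v).resolve_right (h v hve)) hvf hve

theorem edge_bounds (h13 : G.IsOneThreeGraph) {t : ℝ} {x : G.edgeSet → ℝ}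
    (hrule : ∀ (v : G.InternalNode) (a b c : G.edgeSet), G.EdgesAt v a b c →
      x a ≤ x b + x c ∧ x a + x b + x c ≤ 2 * t)
    (hcomp : ∀ e, G.IsComponentEdge e → 0 ≤ x e ∧ x e ≤ t) (e : G.edgeSet) :
    0 ≤ x e ∧ x e ≤ t := by
  rcases isComponentEdge_or_exists_edgesAt h13 e with he | ⟨v, b, c, he⟩
  · exact hcomp e he
  · have ha := hrule v _ _ _ he
    have hb := hrule v _ _ _ (edgesAt_swap_left he)
    have hc := hrule v _ _ _ (edgesAt_swap_left (edgesAt_swap_right he))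
    constructor <;> linarith

theorem mem_smul_polytopeP {t : ℝ} (ht : 0 < t) (x : G.edgeSet → ℝ) : x ∈ t • G.polytopeP ↔
    (∀ (v : G.InternalNode) (a b c : G.edgeSet), G.EdgesAt v a b c →
      x a ≤ x b + x c ∧ x a + x b + x c ≤ t) ∧
    ∀ e, G.IsComponentEdge e → 0 ≤ x e ∧ x e ≤ t / 2 := by
  have hinv := inv_pos.mpr ht
  simp only [Set.mem_smul_set_iff_inv_smul_mem₀ ht.ne', SimpleGraph.polytopeP, Set.mem_ofPred_eq,
    Pi.smul_apply, smul_eq_mul, ← mul_add, mul_le_mul_iff_right₀ hinv, inv_mul_le_iff₀ ht, mul_one,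
    mul_nonneg_iff_of_pos_left hinv, mul_one_div]

theorem mem_smul_polytopeQ {t : ℝ} (ht : 0 < t) (x : G.edgeSet → ℝ) (z : G.InternalNode → ℝ) :
    (x, z) ∈ t • G.polytopeQ ↔
      (∀ (v : G.InternalNode) (a b c : G.edgeSet), G.EdgesAt v a b c →
        x a ≤ x b + x c ∧ x a + x b + x c = 2 * z v ∧ z v ≤ t) ∧
      ∀ e, G.IsComponentEdge e → 0 ≤ x e ∧ x e ≤ t := by
  have hinv := inv_pos.mpr ht
  simp only [Set.mem_smul_set_iff_inv_smul_mem₀ ht.ne', SimpleGraph.polytopeQ, Set.mem_ofPred_eq,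
    Prod.smul_mk, Pi.smul_apply, smul_eq_mul, ← mul_add, mul_left_comm (2 : ℝ) t⁻¹,
    mul_le_mul_iff_right₀ hinv, mul_right_inj' hinv.ne', inv_mul_le_iff₀ ht, mul_one,
    mul_nonneg_iff_of_pos_left hinv]

theorem ehrhartP_zero : G.ehrhartP 0 = 1 :=
  ehrhartFunction_zero (fun _ => ⟨0, by simp⟩) ⟨0, by simp [SimpleGraph.polytopeP]⟩

theorem ehrhartQ_zero : G.ehrhartQ 0 = 1 :=
  ehrhartFunction_zero ⟨fun _ => ⟨0, by simp⟩, fun _ => ⟨0, by simp⟩⟩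
    ⟨0, by simp [SimpleGraph.polytopeQ]⟩

theorem ncard_edgeLabeling_fin_one {N : Fin 1 → Fin 1 → Fin 1 → Prop} (hN : N 0 0 0) :
    {w | IsEdgeLabeling G N w}.ncard = 1 := by
  rw [Set.ncard_eq_one]
  exact ⟨0, Set.eq_singleton_iff_unique_mem.mpr
    ⟨fun _ _ _ _ _ => hN, fun w _ => Subsingleton.elim w 0⟩⟩

theorem ehrhartP_eq_ncard (h13 : G.IsOneThreeGraph) {t m : ℕ} (hm : t / 2 = m) :
    G.ehrhartP t = {w : G.edgeSet → Fin (m + 1) | IsEdgeLabeling G (TriangleRule t) w}.ncard := by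
  rcases t.eq_zero_or_pos with rfl | ht
  · subst hm
    rw [ehrhartP_zero, ncard_edgeLabeling_fin_one (by simp [TriangleRule])]
  rw [← Set.ncard_image_of_injective _ (fin_natCast_comp_injective _ _), SimpleGraph.ehrhartP,
    ehrhartFunction]
  congr 1
  ext x
  rw [Set.mem_inter_iff, mem_smul_polytopeP (Nat.cast_pos.mpr ht)]
  have htm : (t : ℝ) / 2 < (m + 1 : ℕ) := by
    rw [div_lt_iff₀ two_pos]
    exact_mod_cast (by omega : t < (m + 1) * 2)
  constructor
  · rintro ⟨⟨hrule, hcomp⟩, hx⟩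
    have hbounds := edge_bounds h13 (t := t / 2)
      (by simpa only [mul_div_cancel₀ _ (two_ne_zero' ℝ)] using hrule) hcomp
    obtain ⟨w, rfl⟩ := exists_fin_natCast_eq hx fun e =>
      ⟨(hbounds e).1, (hbounds e).2.trans_lt htm⟩
    exact ⟨w, fun v _ _ _ => triangleRule_of_edgesAt (hrule v), rfl⟩
  · rintro ⟨w, hw, rfl⟩
    refine ⟨⟨fun v a b c habc => ?_, fun e _ => ⟨Nat.cast_nonneg _, ?_⟩⟩, fun e => ⟨w e, by simp⟩⟩
    · obtain ⟨ha, -, -, hsum⟩ := hw v a b c habc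
      beta_reduce
      exact ⟨by exact_mod_cast ha, by exact_mod_cast hsum⟩
    · beta_reduce
      rw [le_div_iff₀ two_pos]
      exact_mod_cast (by omega : (w e : ℕ) * 2 ≤ t)

theorem sum_incidentEdges {v : V} (hv : G.degree v = 3) {a b c : G.edgeSet}
    (h : G.EdgesAt v a b c) (x : G.edgeSet → ℝ) :
    ∑ e ∈ incidentEdges G v, x e = x a + x b + x c := by
  classical
  rw [incidentEdges_eq_of_edgesAt hv h, Finset.sum_insert (by simp [h.1, h.2.1]),
    Finset.sum_insert (by simp [h.2.2.1]), Finset.sum_singleton, add_assoc]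

theorem exists_edgesAt {v : V} (hv : G.degree v = 3) : ∃ a b c, G.EdgesAt v a b c := by
  obtain ⟨a, ha⟩ := Finset.card_pos.mp ((card_incidentEdges v).trans hv ▸ three_pos)
  exact ⟨a, exists_edgesAt_of_mem hv (mem_incidentEdges.mp ha)⟩

/-- The point of `ℝ^E × ℝ^I` given by an edge labeling and, at the internal nodes, half the sums
of the labels of the incident edges. -/
noncomputable def halfSumPoint {n : ℕ} (w : G.edgeSet → Fin n) :
    (G.edgeSet → ℝ) × (G.InternalNode → ℝ) :=
  (fun e => (w e : ℕ), fun v => (∑ e ∈ incidentEdges G v, ((w e : ℕ) : ℝ)) / 2)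

theorem halfSumPoint_injective (n : ℕ) :
    Function.Injective (halfSumPoint : (G.edgeSet → Fin n) → _) :=
  fun _ _ h => fin_natCast_comp_injective _ _ (congrArg Prod.fst h)

theorem two_mul_halfSumPoint {n : ℕ} (w : G.edgeSet → Fin n) (v : G.InternalNode)
    {a b c : G.edgeSet} (h : G.EdgesAt v a b c) :
    2 * (halfSumPoint w).2 v = (w a : ℕ) + (w b : ℕ) + (w c : ℕ) := by
  rw [halfSumPoint, mul_div_cancel₀ _ two_ne_zero, sum_incidentEdges v.2 h fun e => (w e : ℕ)]

theorem halfSumPoint_mem_smul_polytopeQ {t : ℕ} (ht : 0 < t)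
    {w : G.edgeSet → Fin (t + 1)} (hw : IsEdgeLabeling G (EvenTriangleRule t) w) :
    halfSumPoint w ∈ (t : ℝ) • G.polytopeQ := by
  refine (mem_smul_polytopeQ (Nat.cast_pos.mpr ht) _ _).mpr
    ⟨fun v a b c habc => ?_, fun e _ => ⟨Nat.cast_nonneg _, ?_⟩⟩
  · have hz := two_mul_halfSumPoint w v habc
    obtain ⟨⟨ha, -, -, hsum⟩, -⟩ := hw v a b c habc
    have hsum : ((w a : ℕ) : ℝ) + (w b : ℕ) + (w c : ℕ) ≤ 2 * t := by exact_mod_cast hsum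
    exact ⟨by exact_mod_cast ha, hz.symm, le_of_mul_le_mul_left (hz.trans_le hsum) two_pos⟩
  · exact_mod_cast (by omega : (w e : ℕ) ≤ t)

theorem halfSumPoint_mem_integerPoints {t n : ℕ} {w : G.edgeSet → Fin n}
    (hw : IsEdgeLabeling G (EvenTriangleRule t) w) :
    halfSumPoint w ∈ integerPoints G.edgeSet ×ˢ integerPoints G.InternalNode := by
  refine ⟨fun e => ⟨w e, rfl⟩, fun v => ?_⟩
  obtain ⟨a, b, c, habc⟩ := exists_edgesAt v.2
  obtain ⟨k, hk⟩ := (hw v a b c habc).2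
  have hz := two_mul_halfSumPoint w v habc
  have hk : ((w a : ℕ) : ℝ) + (w b : ℕ) + (w c : ℕ) = k + k := by exact_mod_cast hk
  exact ⟨k, by push_cast; linarith⟩

theorem exists_edgeLabeling_halfSumPoint_eq (h13 : G.IsOneThreeGraph) {t : ℕ} (ht : 0 < t)
    {x : G.edgeSet → ℝ} {z : G.InternalNode → ℝ} (hmem : (x, z) ∈ (t : ℝ) • G.polytopeQ)
    (hx : x ∈ integerPoints G.edgeSet) (hz : z ∈ integerPoints G.InternalNode) :
    ∃ w : G.edgeSet → Fin (t + 1),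
      IsEdgeLabeling G (EvenTriangleRule t) w ∧ halfSumPoint w = (x, z) := by
  obtain ⟨hrule, hcomp⟩ := (mem_smul_polytopeQ (Nat.cast_pos.mpr ht) x z).mp hmem
  have hsum (v : G.InternalNode) (a b c : G.edgeSet) (habc : G.EdgesAt v a b c) :
      x a ≤ x b + x c ∧ x a + x b + x c ≤ 2 * t := by
    obtain ⟨ha, heq, hle⟩ := hrule v a b c habc
    exact ⟨ha, by linarith⟩
  have hbounds := edge_bounds h13 hsum hcomp
  obtain ⟨w, rfl⟩ := exists_fin_natCast_eq (n := t + 1) hx fun e =>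
    ⟨(hbounds e).1, (hbounds e).2.trans_lt (by simp)⟩
  beta_reduce at hrule hsum
  refine ⟨w, fun v a b c habc => ⟨triangleRule_of_edgesAt (by exact_mod_cast hsum v) habc, ?_⟩,
    Prod.ext rfl (funext fun v => ?_)⟩
  · obtain ⟨k, hk⟩ := hz v
    have heq := (hrule v a b c habc).2.1
    rw [hk] at heq
    have heq : ((w a + w b + w c : ℕ) : ℤ) = 2 * k := by exact_mod_cast heq
    rw [Nat.even_iff]
    omega
  · obtain ⟨a, b, c, habc⟩ := exists_edgesAt v.2
    have := two_mul_halfSumPoint w v habc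
    have := (hrule v a b c habc).2.1
    linarith

theorem ehrhartQ_eq_ncard (h13 : G.IsOneThreeGraph) (t : ℕ) :
    G.ehrhartQ t =
      {w : G.edgeSet → Fin (t + 1) | IsEdgeLabeling G (EvenTriangleRule t) w}.ncard := by
  rcases t.eq_zero_or_pos with rfl | ht
  · rw [ehrhartQ_zero, ncard_edgeLabeling_fin_one (by simp [EvenTriangleRule, TriangleRule])]
  rw [← Set.ncard_image_of_injective _ (halfSumPoint_injective _), SimpleGraph.ehrhartQ,
    ehrhartFunction]
  congr 1
  ext ⟨x, z⟩
  constructor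
  · rintro ⟨hmem, hx, hz⟩
    exact exists_edgeLabeling_halfSumPoint_eq h13 ht hmem hx hz
  · rintro ⟨w, hw, heq⟩
    rw [← heq]
    exact ⟨halfSumPoint_mem_smul_polytopeQ ht hw, halfSumPoint_mem_integerPoints hw⟩

end LatticePoints

section Polynomiality

open MvPolynomial

theorem exists_polynomial_sum_range_pow (n : ℕ) :
    ∃ S : Polynomial ℝ, ∀ k : ℕ, ∑ i ∈ Finset.range k, (i : ℝ) ^ n = S.eval (k : ℝ) := by
  let S : Polynomial ℚ := Polynomial.C (n + 1 : ℚ)⁻¹ *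
    (Polynomial.bernoulli (n + 1) - Polynomial.C (_root_.bernoulli (n + 1)))
  have hS (k : ℕ) : ∑ i ∈ Finset.range k, (i : ℚ) ^ n = S.eval (k : ℚ) := by
    rw [Polynomial.eval_C_mul, Polynomial.eval_sub, Polynomial.eval_C, eq_inv_mul_iff_mul_eq₀
      (by positivity), Polynomial.sum_range_pow_eq_bernoulli_sub]
  refine ⟨S.map (algebraMap ℚ ℝ), fun k => ?_⟩
  rw [Polynomial.eval_natCast_map, ← hS]
  simp

theorem eval_update_monomial {σ : Type*} [DecidableEq σ] (x : σ → ℝ) (k : σ) (y : ℝ) (u : σ →₀ ℕ)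
    (a : ℝ) : eval (Function.update x k y) (monomial u a) =
      eval x (monomial (u.erase k) a) * y ^ u k := by
  rw [eval_monomial, eval_monomial, ← u.mul_prod_erase' k _ fun _ => pow_zero _,
    Function.update_self, Finsupp.prod_congr fun i hi => by
      rw [Function.update_of_ne (Finset.ne_of_mem_erase (u.support_erase ▸ hi))]]
  ring

theorem exists_eval_eq_sum_range_eval_update {σ : Type*} [DecidableEq σ] (P B : MvPolynomial σ ℝ)
    (k : σ) : ∃ S : MvPolynomial σ ℝ, ∀ (x : σ → ℝ) (n : ℕ), eval x B = n →
      ∑ i ∈ Finset.range n, eval (Function.update x k i) P = eval x S := by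
  induction P using MvPolynomial.induction_on' with
  | monomial u a =>
    obtain ⟨S, hS⟩ := exists_polynomial_sum_range_pow (u k)
    refine ⟨monomial (u.erase k) a * Polynomial.aeval B S, fun x n hn => ?_⟩
    simp only [eval_update_monomial, ← Finset.mul_sum, hS, map_mul]
    congr 1
    rw [← hn, ← coe_aeval_eq_eval, AlgHom.coe_toRingHom, ← Polynomial.aeval_algHom_apply,
      Polynomial.coe_aeval_eq_eval]
  | add P Q ihP ihQ =>
    obtain ⟨S, hS⟩ := ihP
    obtain ⟨S', hS'⟩ := ihQ
    exact ⟨S + S', fun x n hn => by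
      simp only [map_add, Finset.sum_add_distrib, hS x n hn, hS' x n hn]⟩

theorem eval_bind₁ {σ τ : Type*} (x : σ → ℝ) (f : τ → MvPolynomial σ ℝ) (P : MvPolynomial τ ℝ) :
    eval x (bind₁ f P) = eval (fun i => eval x (f i)) P :=
  eval₂Hom_bind₁ ..

open Classical in
theorem sum_triangleRule_of_parity {m r : ℕ} (hr : r < 2) (s : Fin (m + 1)) (F : ℕ → ℕ → ℝ) :
    (∑ b : Fin (m + 1), ∑ c : Fin (m + 1),
      if TriangleRule (2 * m) s b c ∧ (s + b + c : ℕ) % 2 = r then F b c else 0) =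
      ∑ i ∈ Finset.range (m - s + 1 - r), ∑ j ∈ Finset.range (s + 1 - r),
        F (s + i - j) (i + j + r) := by
  have hs : (s : ℕ) < m + 1 := s.2
  rw [← Fintype.sum_prod_type', ← Finset.sum_product', ← Finset.sum_filter]
  -- `i` and `j` are the halves of the excesses `b + c - s` and `s + c - b`, rounded down.
  refine Finset.sum_bij' (fun x _ => ((x.1 + x.2 - s : ℕ) / 2, (s + x.2 - x.1 : ℕ) / 2))
    (fun y hy => (⟨s + y.1 - y.2, ?_⟩, ⟨y.1 + y.2 + r, ?_⟩)) ?_ ?_ ?_ ?_ ?_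
  · simp only [Finset.mem_product, Finset.mem_range] at hy
    omega
  · simp only [Finset.mem_product, Finset.mem_range] at hy
    omega
  · rintro ⟨b, c⟩ h
    obtain ⟨-, hrule⟩ := Finset.mem_filter.mp h
    simp only [TriangleRule] at hrule
    simp only [Finset.mem_product, Finset.mem_range]
    omega
  · rintro ⟨i, j⟩ h
    simp only [Finset.mem_product, Finset.mem_range] at h
    refine Finset.mem_filter.mpr ⟨Finset.mem_univ _, ?_⟩
    simp only [TriangleRule]
    omega
  · rintro ⟨b, c⟩ h
    obtain ⟨-, hrule⟩ := Finset.mem_filter.mp h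
    simp only [TriangleRule] at hrule
    simp only [Prod.mk.injEq, Fin.ext_iff]
    omega
  · rintro ⟨i, j⟩ h
    simp only [Finset.mem_product, Finset.mem_range, Prod.mk.injEq] at h ⊢
    omega
  · rintro ⟨b, c⟩ h
    obtain ⟨-, hrule⟩ := Finset.mem_filter.mp h
    simp only [TriangleRule] at hrule
    congr 1 <;> simp only <;> omega

theorem exists_eval_eq_double_sum (P Q : MvPolynomial (Fin 2) ℝ) {r : ℕ} (hr : r < 2) :
    ∃ R : MvPolynomial (Fin 2) ℝ, ∀ m s : ℕ, s ≤ m →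
      ∑ i ∈ Finset.range (m - s + 1 - r), ∑ j ∈ Finset.range (s + 1 - r),
        eval ![(m : ℝ), (s + i - j : ℕ)] P * eval ![(m : ℝ), (i + j + r : ℕ)] Q =
      eval ![(m : ℝ), s] R := by
  let F : MvPolynomial (Fin 4) ℝ :=
    bind₁ ![X 0, X 1 + X 2 - X 3] P * bind₁ ![X 0, X 2 + X 3 + C (r : ℝ)] Q
  obtain ⟨S, hS⟩ := exists_eval_eq_sum_range_eval_update F (X 1 + C (1 - r : ℝ)) 3
  obtain ⟨R, hR⟩ := exists_eval_eq_sum_range_eval_update S (X 0 - X 1 + C (1 - r : ℝ)) 2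
  refine ⟨bind₁ ![X 0, X 1, 0, 0] R, fun m s hs => ?_⟩
  let x : Fin 4 → ℝ := ![m, s, 0, 0]
  have hR' := hR x (m - s + 1 - r) (by
    rw [Nat.cast_sub (by omega)]; push_cast [hs]; simp [x]; ring)
  have hS' (i : ℕ) := hS (Function.update x 2 i) (s + 1 - r) (by
    rw [Nat.cast_sub (by omega)]; push_cast; simp [x]; ring)
  simp only [← hS'] at hR'
  rw [eval_bind₁]
  convert hR' using 1
  · refine Finset.sum_congr rfl fun i _ => Finset.sum_congr rfl fun j hj => ?_
    have hj' : j ≤ s + i := by have := Finset.mem_range.mp hj; omega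
    simp only [F, map_mul, eval_bind₁]
    congr 3 <;> funext a <;> fin_cases a <;> simp [x, Nat.cast_sub hj']
  · congr 2
    funext a
    fin_cases a <;> simp [x]

open Classical in
theorem exists_polynomial_sum_labelCount
    {N : ∀ m : ℕ, Fin (m + 1) → Fin (m + 1) → Fin (m + 1) → Prop}
    (hN : ∀ P Q : MvPolynomial (Fin 2) ℝ, ∃ R : MvPolynomial (Fin 2) ℝ, ∀ m (s : Fin (m + 1)),
      (∑ b : Fin (m + 1), ∑ c : Fin (m + 1),
        if N m s b c then eval ![(m : ℝ), (b : ℕ)] P * eval ![(m : ℝ), (c : ℕ)] Q else 0) =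
      eval ![(m : ℝ), (s : ℕ)] R) (τ : BinaryTree Unit) :
    ∃ p : Polynomial ℝ, ∀ m : ℕ, ((∑ s, labelCount (N m) τ s : ℕ) : ℝ) = p.eval (m : ℝ) := by
  have hlabel : ∃ P : MvPolynomial (Fin 2) ℝ, ∀ m s,
      (labelCount (N m) τ s : ℝ) = eval ![(m : ℝ), (s : ℕ)] P := by
    induction τ with
    | nil => exact ⟨1, fun m s => by simp [labelCount]⟩
    | node _ l r ihl ihr =>
      obtain ⟨P, hP⟩ := ihl
      obtain ⟨Q, hQ⟩ := ihr
      obtain ⟨R, hR⟩ := hN P Q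
      refine ⟨R, fun m s => ?_⟩
      rw [← hR, labelCount]
      push_cast
      simp only [hP, hQ]
  obtain ⟨P, hP⟩ := hlabel
  obtain ⟨S, hS⟩ := exists_eval_eq_sum_range_eval_update P (X 0 + 1) 1
  refine ⟨aeval ![Polynomial.X, 0] S, fun m => ?_⟩
  have hsum := hS ![m, 0] (m + 1) (by simp)
  have hupdate (y : ℝ) : Function.update ![(m : ℝ), 0] 1 y = ![(m : ℝ), y] := by
    funext a
    fin_cases a <;> simp
  have heval : (aeval ![Polynomial.X, 0] S : Polynomial ℝ).eval (m : ℝ) = eval ![(m : ℝ), 0] S := by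
    rw [← Polynomial.coe_aeval_eq_eval, comp_aeval_apply, aeval_eq_eval]
    congr 2
    funext a
    fin_cases a <;> simp
  simp only [hupdate] at hsum
  rw [heval, ← hsum, ← Fin.sum_univ_eq_sum_range fun i : ℕ => eval ![(m : ℝ), i] P]
  push_cast
  simp only [hP]

open Classical in
theorem exists_eval_eq_sum_of_parity (P Q : MvPolynomial (Fin 2) ℝ) {r : ℕ} (hr : r < 2) :
    ∃ R : MvPolynomial (Fin 2) ℝ, ∀ m (s : Fin (m + 1)),
      (∑ b : Fin (m + 1), ∑ c : Fin (m + 1),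
        if TriangleRule (2 * m) s b c ∧ (s + b + c : ℕ) % 2 = r then
          eval ![(m : ℝ), (b : ℕ)] P * eval ![(m : ℝ), (c : ℕ)] Q else 0) =
      eval ![(m : ℝ), (s : ℕ)] R := by
  obtain ⟨R, hR⟩ := exists_eval_eq_double_sum P Q hr
  refine ⟨R, fun m s => ?_⟩
  rw [← hR m s s.is_le, ← sum_triangleRule_of_parity hr s fun b c =>
    eval ![(m : ℝ), b] P * eval ![(m : ℝ), c] Q]

theorem exists_polynomial_sum_labelCount_evenTriangleRule (τ : BinaryTree Unit) :
    ∃ p : Polynomial ℝ, ∀ m : ℕ,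
      ((∑ s : Fin (m + 1), labelCount (EvenTriangleRule m) τ s : ℕ) : ℝ) = p.eval (m : ℝ) := by
  classical
  refine exists_polynomial_sum_labelCount (N := fun m => EvenTriangleRule m) (fun P Q => ?_) τ
  obtain ⟨R, hR⟩ := exists_eval_eq_sum_of_parity P Q two_pos
  exact ⟨R, fun m s => by simp only [← hR, EvenTriangleRule, Nat.even_iff]⟩

theorem exists_polynomial_sum_labelCount_triangleRule (τ : BinaryTree Unit) :
    ∃ p : Polynomial ℝ, ∀ m : ℕ,
      ((∑ s : Fin (m + 1), labelCount (TriangleRule (2 * m)) τ s : ℕ) : ℝ) = p.eval (m : ℝ) := by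
  classical
  refine exists_polynomial_sum_labelCount (N := fun m => TriangleRule (2 * m)) (fun P Q => ?_) τ
  obtain ⟨R₀, hR₀⟩ := exists_eval_eq_sum_of_parity P Q two_pos
  obtain ⟨R₁, hR₁⟩ := exists_eval_eq_sum_of_parity P Q one_lt_two
  refine ⟨R₀ + R₁, fun m s => ?_⟩
  simp only [map_add, ← hR₀, ← hR₁, ← Finset.sum_add_distrib]
  refine Finset.sum_congr rfl fun b _ => Finset.sum_congr rfl fun c _ => ?_
  rcases Nat.mod_two_eq_zero_or_one (s + b + c) with h | h <;> simp [h]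

end Polynomiality

section Reflection

theorem evenTriangleRule_rev_rev_left {t : ℕ} (a b c : Fin (t + 1)) :
    EvenTriangleRule t a.rev b.rev c ↔ EvenTriangleRule t a b c := by
  simp only [EvenTriangleRule, TriangleRule, Fin.val_rev, Nat.even_iff]
  omega

theorem evenTriangleRule_rev_rev_right {t : ℕ} (a b c : Fin (t + 1)) :
    EvenTriangleRule t a b.rev c.rev ↔ EvenTriangleRule t a b c := by
  simp only [EvenTriangleRule, TriangleRule, Fin.val_rev, Nat.even_iff]
  omega

theorem labelCount_evenTriangleRule_rev {t : ℕ} (τ : BinaryTree Unit) (s : Fin (t + 1)) :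
    labelCount (EvenTriangleRule t) τ s.rev = labelCount (EvenTriangleRule t) τ s := by
  classical
  induction τ generalizing s with
  | nil => rfl
  | node _ l r ihl _ =>
    rw [labelCount, labelCount, ← Equiv.sum_comp Fin.revPerm]
    simp only [Fin.revPerm_apply, evenTriangleRule_rev_rev_left, ihl]

/-- The embedding `a ↦ 2a` of `{0, …, m}` onto the even numbers in `{0, …, 2m + 1}`. -/
def doubleFin {m : ℕ} (a : Fin (m + 1)) : Fin (2 * m + 1 + 1) :=
  ⟨2 * a, by omega⟩

theorem sum_doubleFin_add_sum_rev_doubleFin {m : ℕ} {M : Type*} [AddCommMonoid M]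
    (f : Fin (2 * m + 1 + 1) → M) :
    ∑ a : Fin (m + 1), (f (doubleFin a) + f (doubleFin a).rev) = ∑ b, f b := by
  have hbij : Function.Bijective
      (Sum.elim doubleFin (fun a => (doubleFin a).rev) : Fin (m + 1) ⊕ Fin (m + 1) → _) := by
    refine (Fintype.bijective_iff_injective_and_card _).mpr ⟨?_, by simp; omega⟩
    rintro (a | a) (b | b) <;> simp [doubleFin, Fin.ext_iff] <;> omega
  rw [Finset.sum_add_distrib, ← hbij.sum_comp f, Fintype.sum_sum_type]
  rfl

theorem evenTriangleRule_doubleFin {m : ℕ} (a b c : Fin (m + 1)) :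
    EvenTriangleRule (2 * m + 1) (doubleFin a) (doubleFin b) (doubleFin c) ↔
      TriangleRule (2 * m + 1) a b c := by
  simp only [EvenTriangleRule, TriangleRule, doubleFin, Nat.even_iff]
  omega

theorem not_evenTriangleRule_doubleFin_rev_left {m : ℕ} (a b c : Fin (m + 1)) :
    ¬EvenTriangleRule (2 * m + 1) (doubleFin a) (doubleFin b).rev (doubleFin c) := by
  simp only [EvenTriangleRule, doubleFin, Fin.val_rev, Nat.even_iff]
  omega

theorem not_evenTriangleRule_doubleFin_rev_right {m : ℕ} (a b c : Fin (m + 1)) :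
    ¬EvenTriangleRule (2 * m + 1) (doubleFin a) (doubleFin b) (doubleFin c).rev := by
  simp only [EvenTriangleRule, doubleFin, Fin.val_rev, Nat.even_iff]
  omega

theorem labelCount_evenTriangleRule_doubleFin {m : ℕ} (τ : BinaryTree Unit) (s : Fin (m + 1)) :
    labelCount (EvenTriangleRule (2 * m + 1)) τ (doubleFin s) =
      2 ^ τ.numNodes * labelCount (TriangleRule (2 * m + 1)) τ s := by
  classical
  induction τ generalizing s with
  | nil => rfl
  | node _ l r ihl ihr =>
    rw [labelCount, labelCount, ← sum_doubleFin_add_sum_rev_doubleFin, Finset.mul_sum]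
    simp only [← sum_doubleFin_add_sum_rev_doubleFin, evenTriangleRule_doubleFin,
      evenTriangleRule_rev_rev_right, not_evenTriangleRule_doubleFin_rev_left,
      not_evenTriangleRule_doubleFin_rev_right, labelCount_evenTriangleRule_rev, ihl, ihr,
      BinaryTree.numNodes, if_false, add_zero, zero_add, Finset.mul_sum, mul_ite, mul_zero,
      ← Finset.sum_add_distrib]
    refine Finset.sum_congr rfl fun b _ => Finset.sum_congr rfl fun c _ => ?_
    split_ifs
    · ring
    · rfl

theorem sum_labelCount_evenTriangleRule {m : ℕ} (τ : BinaryTree Unit) :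
    ∑ s, labelCount (EvenTriangleRule (2 * m + 1) (n := 2 * m + 1 + 1)) τ s =
      2 ^ (τ.numNodes + 1) * ∑ s, labelCount (TriangleRule (2 * m + 1) (n := m + 1)) τ s := by
  simp only [← sum_doubleFin_add_sum_rev_doubleFin, labelCount_evenTriangleRule_rev,
    labelCount_evenTriangleRule_doubleFin, ← two_mul, Finset.mul_sum, pow_succ', mul_assoc]

end Reflection

section QuasiPolynomial

theorem polynomial_eq_of_frequently_eval_eq {p q : Polynomial ℝ}
    (h : ∃ᶠ t : ℕ in Filter.atTop, p.eval (t : ℝ) = q.eval (t : ℝ)) : p = q := by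
  refine Polynomial.eq_of_infinite_eval_eq p q
    (((Nat.frequently_atTop_iff_infinite.mp h).image Nat.cast_injective.injOn).mono ?_)
  rintro _ ⟨t, ht, rfl⟩
  exact ht

theorem isQuasiPolynomialOfPeriod_one {f : ℕ → ℕ} {p : Polynomial ℝ}
    (h : ∀ t, (f t : ℝ) = p.eval (t : ℝ)) : IsQuasiPolynomialOfPeriod f 1 :=
  ⟨⟨one_pos, fun _ => p, fun _ t _ => h t⟩, fun _ hβ => hβ.1⟩

theorem isQuasiPolynomialOfPeriod_two {f : ℕ → ℕ} {p q : Polynomial ℝ}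
    (hp : ∀ t, Even t → (f t : ℝ) = p.eval (t : ℝ))
    (hq : ∀ t, Odd t → (f t : ℝ) = q.eval (t : ℝ)) (hpq : p ≠ q) :
    IsQuasiPolynomialOfPeriod f 2 := by
  refine ⟨⟨two_pos, ![p, q], fun i t ht => ?_⟩, ?_⟩
  · fin_cases i
    · exact hp t (Nat.even_iff.mpr ht)
    · exact hq t (Nat.odd_iff.mpr ht)
  · rintro β ⟨hβ, u, hu⟩
    by_contra! hlt
    obtain rfl : β = 1 := by omega
    have hu' (t : ℕ) : (f t : ℝ) = (u 0).eval (t : ℝ) := hu 0 t Nat.modEq_one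
    have hpu : p = u 0 := polynomial_eq_of_frequently_eval_eq <|
      Nat.frequently_even.mono fun t ht => by rw [← hp t ht, hu']
    have hqu : q = u 0 := polynomial_eq_of_frequently_eval_eq <|
      Nat.frequently_odd.mono fun t ht => by rw [← hq t ht, hu']
    exact hpq (hpu.trans hqu.symm)

end QuasiPolynomial

section Ehrhart

variable {V : Type*} [Fintype V] {G : SimpleGraph V} [DecidableRel G.Adj]

theorem exists_ehrhart_eq_sum_labelCount (hG : G.IsTree) (h13 : G.IsOneThreeGraph) :
    ∃ τ : BinaryTree Unit,
      (∀ t m : ℕ, t / 2 = m → G.ehrhartP t = ∑ s : Fin (m + 1), labelCount (TriangleRule t) τ s) ∧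
      ∀ t : ℕ, G.ehrhartQ t = ∑ s : Fin (t + 1), labelCount (EvenTriangleRule t) τ s := by
  obtain ⟨τ, hτ⟩ := exists_card_edgeLabeling_eq_sum_labelCount hG h13
  refine ⟨τ, fun t m hm => ?_, fun t => ?_⟩
  · rw [ehrhartP_eq_ncard h13 hm, ← Nat.card_coe_set_eq]
    exact hτ (by simp only [TriangleRule]; omega) (by simp only [TriangleRule]; omega)
  · rw [ehrhartQ_eq_ncard h13, ← Nat.card_coe_set_eq]
    exact hτ (by simp only [EvenTriangleRule, TriangleRule, Nat.even_iff]; omega)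
      (by simp only [EvenTriangleRule, TriangleRule, Nat.even_iff]; omega)

theorem exists_ehrhartQ_eq_eval (hG : G.IsTree) (h13 : G.IsOneThreeGraph) :
    ∃ p : Polynomial ℝ, ∀ t : ℕ, (G.ehrhartQ t : ℝ) = p.eval (t : ℝ) := by
  obtain ⟨τ, -, hQ⟩ := exists_ehrhart_eq_sum_labelCount hG h13
  simpa only [hQ] using exists_polynomial_sum_labelCount_evenTriangleRule τ

theorem exists_ehrhartP_eq_eval_of_even (hG : G.IsTree) (h13 : G.IsOneThreeGraph) :
    ∃ p : Polynomial ℝ, ∀ t : ℕ, Even t → (G.ehrhartP t : ℝ) = p.eval (t : ℝ) := by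
  obtain ⟨τ, hP, -⟩ := exists_ehrhart_eq_sum_labelCount hG h13
  obtain ⟨p, hp⟩ := exists_polynomial_sum_labelCount_triangleRule τ
  refine ⟨p.comp (.C 2⁻¹ * .X), ?_⟩
  rintro _ ⟨m, rfl⟩
  rw [← two_mul, hP (2 * m) m (by omega), hp]
  simp

theorem exists_ehrhartQ_eq_two_pow_mul_ehrhartP (hG : G.IsTree) (h13 : G.IsOneThreeGraph) :
    ∃ n : ℕ, ∀ t : ℕ, Odd t → G.ehrhartQ t = 2 ^ (n + 1) * G.ehrhartP t := by
  obtain ⟨τ, hP, hQ⟩ := exists_ehrhart_eq_sum_labelCount hG h13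
  refine ⟨τ.numNodes, ?_⟩
  rintro _ ⟨m, rfl⟩
  rw [hQ, sum_labelCount_evenTriangleRule, hP (2 * m + 1) m (by omega)]

end Ehrhart

theorem mainTheorem2 {V : Type*} [Fintype V] (T : SimpleGraph V) [DecidableRel T.Adj]
    (hT : T.IsTree) (hT13 : T.IsOneThreeGraph) :
    IsQuasiPolynomialOfPeriod T.ehrhartP 2 ∧ IsQuasiPolynomialOfPeriod T.ehrhartQ 1 := by
  obtain ⟨p, hp⟩ := exists_ehrhartP_eq_eval_of_even hT hT13
  obtain ⟨q, hq⟩ := exists_ehrhartQ_eq_eval hT hT13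
  obtain ⟨n, hn⟩ := exists_ehrhartQ_eq_two_pow_mul_ehrhartP hT hT13
  have hPodd (t : ℕ) (ht : Odd t) :
      (T.ehrhartP t : ℝ) = (.C (2 ^ (n + 1))⁻¹ * q : Polynomial ℝ).eval (t : ℝ) := by
    rw [Polynomial.eval_C_mul, ← hq, hn t ht]
    simp
  have hp0 : p.eval 0 = 1 := by simpa [ehrhartP_zero] using (hp 0 Even.zero).symm
  have hq0 : q.eval 0 = 1 := by simpa [ehrhartQ_zero] using (hq 0).symm
  have hpq : p ≠ .C (2 ^ (n + 1))⁻¹ * q := by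
    intro heq
    have heval := congrArg (Polynomial.eval 0) heq
    rw [Polynomial.eval_C_mul, hp0, hq0, mul_one] at heval
    exact (inv_lt_one_of_one_lt₀ (one_lt_pow₀ one_lt_two n.succ_ne_zero)).ne' heval
  exact ⟨isQuasiPolynomialOfPeriod_two hp hPodd hpq, isQuasiPolynomialOfPeriod_one hq⟩
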